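/- For a positive integer $n$ let $\Phi_n(x)\in\mathbb{Z}[x]$ be the $n$-th cyclotomic polynomial and let $A(n)$ be its height, i.e. the greatest absolute value of a coefficient of $\Phi_n(x)$. Call $\Phi_n(x)$ flat if $A(n)=1$. Let $p<q<r$ be primes and let $w$ be a positive integer such that $r\equiv w\pmod{pq}$ or $r\equiv -w\pmod{pq}$, and such that $p\equiv 1\pmod w$ and $q\equiv 1\pmod{pw}$. Then $A(pqr)=1$; that is, $\Phi_{pqr}(x)$ is flat. -/

import Mathlib

/-- The height of an integer polynomial: the greatest absolute value of its coefficients. -/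
def Polynomial.coeffHeight (f : Polynomial ℤ) : ℕ :=
  f.support.sup fun k => (f.coeff k).natAbs

/-- `A(n)`: the height of the `n`-th cyclotomic polynomial. -/
noncomputable def cyclotomicHeight (n : ℕ) : ℕ :=
  (Polynomial.cyclotomic n ℤ).coeffHeight

/-! Write p = 1 + lw, t = kw, q = 1 + pt. Then Φ_pqr(X) = Φ_pq(X^r)/Φ_pq(X), and the coefficients of
1/Φ_pq have period pq: χ(x) = W(x) - W(x - q), with W the indicator of the residues 0, …, p - 1.
Moreover Φ_pq = ∑ X^(pN) - ∑ X^(pN + ⌊N/t⌋ + 1), and the two families of exponents alternate. Hence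
a coefficient of Φ_pqr sums χ over the first K' positive exponents and subtracts the sum over the
first K negative ones, with K' = K or K + 1. Periodicity replaces r by ±w, and χ(p + q - 1 - x) =
-χ(x) removes the sign.

Put n ≡ bq + wpi mod pq. Then W is nonzero on a term iff some c in [0, p) solves one congruence mod
p and one mod q (`residueWindow_sub_mul`). The positive sum becomes one indicator for b minus one
for b - 1. The negative sum runs over the c with q - t ≤ i + ck < q; since b enters only through b -
c, its difference between b and b - 1 telescopes to the thresholds where i + ck passes q - t, q - t
+ s and q (K = Jt + s). Five indicators remain, and `abs_boundary_sum_le_one` bounds their signed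
sum by 1. -/

/-! ### Identities for Φ_pq and Φ_pqr. -/

open Polynomial in
theorem cyclotomic_mul_prime_mul_prime_identity {p q : ℕ} (hp : p.Prime) (hq : q.Prime)
    (hpq : p < q) :
    cyclotomic (p * q) ℤ * ((X ^ p - 1) * (X ^ q - 1)) = (X ^ (p * q) - 1) * (X - 1) := by
  have hnd : ¬ q ∣ p := fun h => absurd (Nat.le_of_dvd hp.pos h) (by omega)
  have h1 := cyclotomic_expand_eq_cyclotomic_mul hq hnd ℤ
  have := Fact.mk hp
  have h2 := cyclotomic_prime_mul_X_sub_one ℤ p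
  have h3 := congrArg (expand ℤ q) h2
  simp only [map_mul, map_sub, map_pow, expand_X, map_one, ← pow_mul] at h3
  rw [h1, mul_comm q p] at h3
  rw [← h3, ← h2]
  ring

open Polynomial in
theorem cyclotomic_ternary_identity {p q r : ℕ} (hp : p.Prime) (hq : q.Prime) (hr : r.Prime)
    (hpq : p < q) (hqr : q < r) :
    cyclotomic (p * q * r) ℤ * (1 - X ^ (p * q)) =
      expand ℤ r (cyclotomic (p * q) ℤ) * ((1 - X ^ q) * ∑ c ∈ Finset.range p, X ^ c) := by
  have hnd : ¬ r ∣ p * q := by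
    rw [hr.dvd_mul]
    rintro (h | h)
    · exact absurd (Nat.le_of_dvd hp.pos h) (by omega)
    · exact absurd (Nat.le_of_dvd hq.pos h) (by omega)
  have h1 := cyclotomic_expand_eq_cyclotomic_mul hr hnd ℤ
  have h2 := cyclotomic_mul_prime_mul_prime_identity hp hq hpq
  have h3 : (∑ c ∈ Finset.range p, (X : ℤ[X]) ^ c) * (X - 1) = X ^ p - 1 := geom_sum_mul _ _
  have h4 : (X - 1 : ℤ[X]) ≠ 0 := X_sub_C_ne_zero (1 : ℤ)
  apply mul_right_cancel₀ h4
  rw [h1]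
  linear_combination (cyclotomic (p * q * r) ℤ) * h2 +
    (cyclotomic (p * q * r) ℤ * cyclotomic (p * q) ℤ * (X ^ q - 1)) * h3

open Polynomial in
/-- The explicit form of `Φ_{pq}` when `q = 1 + p t`. -/
theorem cyclotomic_eq_sub_of_eq_one_add_mul {p q t : ℕ} (hp : p.Prime) (hq : q.Prime)
    (hpq : p < q) (ht : q = 1 + p * t) :
    cyclotomic (p * q) ℤ = ∑ i ∈ Finset.range ((p - 1) * t + 1), X ^ (i * p) -
      ∑ N ∈ Finset.range ((p - 1) * t), X ^ (p * N + N / t + 1) := by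
  have ht0 : 0 < t := by
    rcases Nat.eq_zero_or_pos t with h | h
    · subst h; have := hq.one_lt; omega
    · exact h
  have hp1 : (X ^ p - 1 : ℤ[X]) ≠ 0 := X_pow_sub_C_ne_zero hp.pos (1 : ℤ)
  have hq1 : (X ^ q - 1 : ℤ[X]) ≠ 0 := X_pow_sub_C_ne_zero hq.pos (1 : ℤ)
  apply mul_right_cancel₀ (mul_ne_zero hp1 hq1)
  rw [cyclotomic_mul_prime_mul_prime_identity hp hq hpq]
  obtain ⟨m, rfl⟩ : ∃ m, p = m + 1 := ⟨p - 1, by have := hp.pos; omega⟩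
  simp only [Nat.add_sub_cancel]
  have hA : (∑ i ∈ Finset.range (m * t + 1), (X : ℤ[X]) ^ (i * (m + 1))) * (X ^ (m + 1) - 1)
      = X ^ (m * q + 1) - 1 := by
    have := geom_sum_mul ((X : ℤ[X]) ^ (m + 1)) (m * t + 1)
    simp only [← pow_mul] at this
    rw [show m * q + 1 = (m + 1) * (m * t + 1) by rw [ht]; ring, ← this]
    simp only [mul_comm]
  -- Cut into blocks of length t: on block j the exponents are jq + 1 + px with x < t, a geometric
  -- progression of ratio X^p.
  have hB : ∀ n : ℕ, (∑ N ∈ Finset.range (n * t), (X : ℤ[X]) ^ ((m + 1) * N + N / t + 1)) *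
      (X ^ (m + 1) - 1) = ∑ j ∈ Finset.range n, X ^ (j * q + 1) * (X ^ (q - 1) - 1) := by
    intro n
    induction n with
    | zero => simp
    | succ n ih =>
      rw [Finset.sum_range_succ, ← ih, Nat.succ_mul, Finset.sum_range_add, add_mul]
      congr 1
      have := geom_sum_mul ((X : ℤ[X]) ^ (m + 1)) t
      simp only [← pow_mul] at this
      rw [show q - 1 = (m + 1) * t by omega, ← this, ← mul_assoc, Finset.mul_sum]
      congr 1
      refine Finset.sum_congr rfl fun x hx => ?_
      have hx' : x < t := Finset.mem_range.1 hx
      rw [← pow_add]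
      congr 1
      rw [show (n * t + x) / t = n by
        rw [mul_comm, Nat.mul_add_div ht0, Nat.div_eq_of_lt hx', add_zero], ht]
      ring
  have hC := geom_sum_mul ((X : ℤ[X]) ^ q) m
  have hsum : ∑ j ∈ Finset.range m, (X : ℤ[X]) ^ (j * q + 1) * (X ^ (q - 1) - 1) =
      (∑ j ∈ Finset.range m, ((X : ℤ[X]) ^ q) ^ j) * (X ^ q - X) := by
    rw [Finset.sum_mul]
    refine Finset.sum_congr rfl fun j _ => ?_
    have : (X : ℤ[X]) ^ q = X * X ^ (q - 1) := by
      rw [← pow_succ']; congr 1; have := hq.pos; omega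
    rw [pow_succ, mul_comm j q, pow_mul]
    nth_rewrite 3 [this]
    ring
  have hB' := (hB m).trans hsum
  rw [show m * q + 1 = q * m + 1 by ring, pow_add _ (q * m), pow_mul _ q m] at hA
  rw [show (m + 1) * q = q * m + q by ring, pow_add, pow_mul]
  linear_combination (-(X ^ q - 1)) * hA + (X ^ q - 1) * hB' + (X ^ q - X) * hC

/-! ### Coefficients of Φ_pqr through the periodic series 1/Φ_pq. -/

/-- The `n`-th coefficient of the power series `1 / Φ_{pq}`, extended periodically to `ℤ`. -/
def invCyclotomicCoeff (p q : ℕ) (x : ℤ) : ℤ :=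
  (if x % (p * q) < p then 1 else 0) - (if (x - q) % (p * q) < p then 1 else 0)

theorem invCyclotomicCoeff_congr (p q : ℕ) {x y : ℤ} (h : x ≡ y [ZMOD (p * q)]) :
    invCyclotomicCoeff p q x = invCyclotomicCoeff p q y := by
  have h2 : x - q ≡ y - q [ZMOD (p * q)] := h.sub_right _
  unfold invCyclotomicCoeff
  rw [h, h2]

/-- Here 1/Φ_pq = (1 - X^q)(1 + ⋯ + X^(p-1))/(1 - X^(pq)); as p + q ≤ pq, the numerator fits in one
period. -/
theorem coe_cyclotomic_ternary_eq {p q r : ℕ} (hp : p.Prime) (hq : q.Prime) (hr : r.Prime)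
    (hpq : p < q) (hqr : q < r) :
    (Polynomial.cyclotomic (p * q * r) ℤ : PowerSeries ℤ) =
      (Polynomial.expand ℤ r (Polynomial.cyclotomic (p * q) ℤ) : PowerSeries ℤ) *
        PowerSeries.mk fun n => invCyclotomicCoeff p q n := by
  have hp2 := hp.two_le
  have hle : p + q ≤ p * q := by nlinarith
  have hleZ : (p : ℤ) + q ≤ p * q := by exact_mod_cast hle
  have key : (PowerSeries.mk fun n => invCyclotomicCoeff p q n) *
      ((1 - Polynomial.X ^ (p * q) : Polynomial ℤ) : PowerSeries ℤ) =
      (((1 - Polynomial.X ^ q) * ∑ c ∈ Finset.range p, Polynomial.X ^ c : Polynomial ℤ) :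
        PowerSeries ℤ) := by
    ext n
    have e1 : ((1 - Polynomial.X ^ (p * q) : Polynomial ℤ) : PowerSeries ℤ) =
      1 - PowerSeries.X ^ (p * q) := by simp
    rw [e1, mul_sub, mul_one, mul_comm _ (PowerSeries.X ^ (p * q)), map_sub,
      PowerSeries.coeff_X_pow_mul', Polynomial.coeff_coe, sub_mul, one_mul,
      Polynomial.coeff_sub, Polynomial.coeff_X_pow_mul']
    simp only [PowerSeries.coeff_mk, Polynomial.finsetSum_coeff, Polynomial.coeff_X_pow,
      Finset.sum_ite_eq, Finset.mem_range]
    by_cases h : p * q ≤ n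
    · rw [if_pos h, if_neg (by omega), if_pos (by omega), if_neg (by omega),
        invCyclotomicCoeff_congr p q (x := (n : ℤ)) (y := ((n - p * q : ℕ) : ℤ)), sub_self,
        sub_self]
      push_cast [h]
      exact (Int.modEq_iff_dvd.2 ⟨-1, by ring⟩)
    · rw [if_neg h, sub_zero, invCyclotomicCoeff]
      have hn : (n : ℤ) < p * q := by exact_mod_cast not_le.1 h
      congr 1
      · rw [Int.emod_eq_of_lt (by omega) hn]
        simp
      · by_cases hqn : q ≤ n
        · rw [Int.emod_eq_of_lt (by omega) (by omega), if_pos hqn]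
          congr 1
          apply propext; omega
        · rw [if_neg hqn, if_neg]
          have : ((n : ℤ) - q) % (p * q) = n - q + p * q := by
            rw [← Int.add_emod_right, Int.emod_eq_of_lt (by omega) (by omega)]
          omega
  have hne : ((1 - Polynomial.X ^ (p * q) : Polynomial ℤ) : PowerSeries ℤ) ≠ 0 := by
    intro h
    have := congrArg (PowerSeries.coeff 0) h
    have h0 : 0 ≠ p * q := by omega
    simp [hp.ne_zero, hq.ne_zero, eq_comm] at this
  apply mul_right_cancel₀ hne
  rw [mul_assoc (Polynomial.toPowerSeries _), key, ← Polynomial.coe_mul, ← Polynomial.coe_mul,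
    cyclotomic_ternary_identity hp hq hr hpq hqr]

theorem coeff_cyclotomic_ternary {p q r t : ℕ} (hp : p.Prime) (hq : q.Prime) (hr : r.Prime)
    (hpq : p < q) (hqr : q < r) (ht : q = 1 + p * t) (n : ℕ) :
    (Polynomial.cyclotomic (p * q * r) ℤ).coeff n =
      (∑ i ∈ Finset.range ((p - 1) * t + 1), if i * p * r ≤ n then
        invCyclotomicCoeff p q ((n : ℤ) - i * p * r) else 0) -
      ∑ N ∈ Finset.range ((p - 1) * t), if (p * N + N / t + 1) * r ≤ n then
        invCyclotomicCoeff p q ((n : ℤ) - ((p * N + N / t + 1 : ℕ) : ℤ) * r) else 0 := by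
  rw [← Polynomial.coeff_coe, coe_cyclotomic_ternary_eq hp hq hr hpq hqr,
    cyclotomic_eq_sub_of_eq_one_add_mul hp hq hpq ht]
  simp only [map_sub, map_sum, map_pow, Polynomial.expand_X, ← pow_mul, Polynomial.coe_sub]
  have cs : ∀ (s : Finset ℕ) (f : ℕ → ℕ), ((∑ i ∈ s, Polynomial.X ^ f i : Polynomial ℤ) :
      PowerSeries ℤ) = ∑ i ∈ s, PowerSeries.X ^ f i := by
    intro s f
    have := map_sum (Polynomial.coeToPowerSeries.ringHom (R := ℤ)) (fun i => Polynomial.X ^ f i) s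
    exact this.trans (Finset.sum_congr rfl fun i _ => by
      rw [Polynomial.coeToPowerSeries.ringHom_apply, Polynomial.coe_pow, Polynomial.coe_X])
  rw [cs, cs, sub_mul, map_sub, Finset.sum_mul, Finset.sum_mul, map_sum, map_sum]
  simp only [PowerSeries.coeff_X_pow_mul', PowerSeries.coeff_mk]
  congr 1
  · refine Finset.sum_congr rfl fun i _ => ?_
    rw [mul_comm r]
    split_ifs with h
    · push_cast [h]; rfl
    · rfl
  · refine Finset.sum_congr rfl fun i _ => ?_
    rw [mul_comm r]
    split_ifs with h
    · rw [Nat.cast_sub h, Nat.cast_mul]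
    · rfl

/-! ### Division by w modulo p. -/

/-- For `p = 1 + l w`, the residue modulo `p` of `x / w`. -/
def divResidue (p l x : ℤ) : ℤ := -(l * x) % p

theorem divResidue_nonneg {p : ℤ} (hp : 0 < p) (l x : ℤ) : 0 ≤ divResidue p l x :=
  Int.emod_nonneg _ hp.ne'

theorem divResidue_lt {p : ℤ} (hp : 0 < p) (l x : ℤ) : divResidue p l x < p :=
  Int.emod_lt_of_pos _ hp

/-- Since lw ≡ -1 mod p, the inverse of w is -l. -/
theorem exists_mul_divResidue {p l w : ℤ} (hp : p = 1 + l * w) (x : ℤ) :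
    ∃ e, w * divResidue p l x = x + e * p := by
  refine ⟨-x - w * (-(l * x) / p), ?_⟩
  have := Int.emod_add_mul_ediv (-(l * x)) p
  unfold divResidue
  linear_combination w * this + x * hp

theorem divResidue_sub {p l m : ℤ} (hp : 0 < p) (x y : ℤ) (hm : m = l * y) (hm0 : 0 ≤ m)
    (hmp : m < p) :
    divResidue p l (x - y) = divResidue p l x + m ∨
      divResidue p l (x - y) = divResidue p l x + m - p := by
  have h : divResidue p l (x - y) = (divResidue p l x + m) % p := by
    unfold divResidue
    rw [Int.emod_add_emod, hm]
    congr 1; ring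
  have h0 := divResidue_nonneg hp l x
  have h1 := divResidue_lt hp l x
  rw [h]
  by_cases h2 : divResidue p l x + m < p
  · left; exact Int.emod_eq_of_lt (by omega) h2
  · right
    rw [← Int.sub_emod_right, Int.emod_eq_of_lt (by omega) (by omega)]

theorem divResidue_sub_self {p l x : ℤ} : divResidue p l (x - p) = divResidue p l x := by
  unfold divResidue
  rw [show -(l * (x - p)) = -(l * x) + p * l by ring, Int.add_mul_emod_self_left]

theorem eq_or_of_divResidue_sub_eq_zero {p l w b c : ℤ} (hp0 : 0 < p) (hp : p = 1 + l * w)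
    (hb : 0 ≤ b) (hbp : b < p) (hc : 0 ≤ c) (hcp : c ≤ p) (h : divResidue p l (b - c) = 0) :
    b = c ∨ (b = 0 ∧ c = p) := by
  obtain ⟨e, he⟩ := exists_mul_divResidue hp (b - c)
  rw [h, mul_zero] at he
  have h1 : e < 2 := by nlinarith
  have h2 : -1 < e := by nlinarith
  have : e = 0 ∨ e = 1 := by omega
  rcases this with rfl | rfl
  · left; linarith
  · right; constructor <;> linarith

/-! ### Threshold crossings of the progression i + ck. -/

/-- `c` is the first index in `[0, p)` with `i + c k ≥ θ`, or `p` if there is none. -/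
structure IsFirstIndex (p k i θ c : ℤ) : Prop where
  nonneg : 0 ≤ c
  le : c ≤ p
  lt_iff : ∀ x, 0 ≤ x → x < p → (x < c ↔ i + x * k < θ)

theorem exists_isFirstIndex {p k : ℤ} (hp : 0 ≤ p) (hk : 0 < k) (i θ : ℤ) :
    ∃ c, IsFirstIndex p k i θ c := by
  have key : ∀ x, x < -((i - θ) / k) ↔ i + x * k < θ := by
    intro x
    rw [lt_neg, Int.ediv_lt_iff_lt_mul hk]
    constructor <;> intro h <;> nlinarith
  refine ⟨max 0 (min p (-((i - θ) / k))), le_max_left _ _, by simp [hp], fun x hx hxp => ?_⟩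
  rw [← key x]
  simp only [lt_max_iff, lt_min_iff]
  omega

theorem IsFirstIndex.mono {p k i θ θ' c c' : ℤ} (h : IsFirstIndex p k i θ c)
    (h' : IsFirstIndex p k i θ' c') (hθ : θ ≤ θ') : c ≤ c' := by
  by_contra! hc
  have h1 := (h.lt_iff c' h'.nonneg (hc.trans_le h.le)).1 hc
  exact absurd ((h'.lt_iff c' h'.nonneg (hc.trans_le h.le)).2 (h1.trans_le hθ)) (lt_irrefl _)

theorem IsFirstIndex.le_add {p k i θ w t c c' : ℤ} (hw : 0 ≤ w) (ht : t = k * w)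
    (h : IsFirstIndex p k i (θ - t) c) (h' : IsFirstIndex p k i θ c') : c' ≤ c + w := by
  by_contra! hc
  have hc0 := h.nonneg
  have hcp := h'.le
  have h1 := (h'.lt_iff (c + w) (by omega) (by omega)).1 hc
  exact absurd ((h.lt_iff c hc0 (by omega)).2 (by linarith)) (lt_irrefl _)

/-- Raising the threshold by t = kw costs exactly w steps of size k, unless an index is clipped:
`hi` prevents clipping at 0, `hc'` clipping at p. -/
theorem IsFirstIndex.eq_add {p k i θ w t c c' : ℤ} (hk : 0 ≤ k) (hw : 0 ≤ w) (ht : t = k * w)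
    (h : IsFirstIndex p k i (θ - t) c) (h' : IsFirstIndex p k i θ c') (hi : i < θ - t)
    (hc' : c' < p) : c' = c + w := by
  subst ht
  have h0 := h'.nonneg
  have h1 : θ ≤ i + c' * k := by
    by_contra! hc
    exact absurd ((h'.lt_iff c' h0 hc').2 hc) (lt_irrefl _)
  apply le_antisymm (h.le_add hw rfl h')
  by_contra! hc
  have hw' : w ≤ c' := by
    by_contra! hlt
    nlinarith
  have := (h.lt_iff (c' - w) (by omega) (by omega)).1 (by omega)
  linarith

/-! ### Size estimates and the five boundary indicators. -/

/-- A congruence mod p becomes an inequality once the quotient e is bounded: w(J + 1) < wp and c < p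
force e ≤ w. The next two lemmas use the same device, with e ≤ w - 1 and e ≥ 0. -/
theorem mul_add_le_of_mul_succ_eq {p w k J c e i s : ℤ} (hk : 0 < k) (hp : 0 < p) (hw : 0 < w)
    (h : w * (J + 1) = -c + e * p) (hJ : J + 1 < p) (hc : c < p)
    (hi : 1 + p * (k * w) - k * w + s ≤ i + c * k) : J * (k * w) + s + 1 ≤ i := by
  have h1 : w * (J + 1) < w * p := mul_lt_mul_of_pos_left hJ hw
  have hew : e < w + 1 := by
    refine lt_of_mul_lt_mul_right ?_ hp.le
    linarith
  have h2 : 0 ≤ (w - e) * p * k := mul_nonneg (mul_nonneg (by linarith) hp.le) hk.le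
  have h3 : c * k = e * p * k - (J + 1) * (k * w) := by linear_combination k * h
  linarith

theorem not_mul_lt_mul_of_mul_eq {p w k b e D : ℤ} (hk : 0 < k) (hp : 0 < p) (hw : 0 < w)
    (h : w * D = b + e * p) (hD : D < p) (hb : 0 ≤ b) : ¬ (p - D) * (k * w) < (p - b) * k := by
  intro hlt
  have h1 : (p - D) * w < p - b := by
    refine lt_of_mul_lt_mul_right ?_ hk.le
    linarith
  have h2 : w * D < w * p := mul_lt_mul_of_pos_left hD hw
  have hew : e < w := by
    refine lt_of_mul_lt_mul_right ?_ hp.le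
    linarith
  have h3 : 0 ≤ (w - 1 - e) * p := mul_nonneg (by linarith) hp.le
  linarith

theorem mul_le_mul_of_mul_eq {p w k b e D : ℤ} (hk : 0 < k) (hp : 0 < p) (hw : 0 < w)
    (h : w * D = b + e * p) (hD : 0 ≤ D) (hb : b < p) : b * k ≤ D * (k * w) := by
  have h1 : 0 ≤ w * D := mul_nonneg hw.le hD
  have he : -1 < e := by
    refine lt_of_mul_lt_mul_right ?_ hp.le
    linarith
  have h2 : 0 ≤ e * p * k := mul_nonneg (mul_nonneg (by linarith) hp.le) hk.le
  have h3 : D * (k * w) = b * k + e * p * k := by linear_combination k * h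
  linarith

theorem abs_ite_sum_le_one {P P' A B C : Prop} [Decidable P] [Decidable P'] [Decidable A]
    [Decidable B] [Decidable C] (h₁ : P → ¬ P' → (¬ B ∧ ¬ C) ∨ (A ∧ ¬ (B ∧ C)))
    (h₂ : ¬ P → P' → A → B ∨ C) (h₃ : B → C → A) :
    |(if P then (1 : ℤ) else 0) - (if P' then 1 else 0) - (if A then 1 else 0) +
      (if B then 1 else 0) + (if C then 1 else 0)| ≤ 1 := by
  by_cases P <;> by_cases P' <;> by_cases A <;> by_cases B <;> by_cases C <;> simp_all

-- Let D₀, D₁, D₂ be the residues of (b - c)/w at c = c₀, c₁, c₂. Then D₁ and D₂ arise from D₀ by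
-- adding m₁ ≤ m₂ ≤ p - 1 mod p, and D₂ ≡ D₀ - 1 when the crossing takes the full w steps. Here K is
-- the number of positive terms.
set_option maxHeartbeats 400000 in
theorem abs_boundary_sum_le_one {p q w k l t J s K i b c₀ c₁ c₂ : ℤ} (hw : 0 < w) (hk : 0 < k)
    (hl : 0 < l) (hp : p = 1 + l * w) (ht : t = k * w) (hq : q = 1 + p * t) (hJ : 0 ≤ J)
    (hs : 0 ≤ s) (hst : s < t) (hK : J * t + s ≤ K) (hK' : K ≤ J * t + s + 1)
    (hKq : K ≤ q - t) (hK0 : 0 ≤ K) (hi : 0 ≤ i) (hiq : i < q) (hb : 0 ≤ b) (hbp : b < p)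
    (h₀ : IsFirstIndex p k i (q - t) c₀) (h₁ : IsFirstIndex p k i (q - t + s) c₁)
    (h₂ : IsFirstIndex p k i q c₂) :
    |(if (i + b * k) % q < K then (1 : ℤ) else 0) -
      (if (i + (b - 1) % p * k) % q < K then 1 else 0) -
      (if 1 ≤ divResidue p l (b - c₀) ∧ divResidue p l (b - c₀) ≤ J + 1 then 1 else 0) +
      (if 1 ≤ divResidue p l (b - c₂) ∧ divResidue p l (b - c₂) ≤ J then 1 else 0) +
      (if divResidue p l (b - c₁) = J + 1 then 1 else 0)| ≤ 1 := by
  have hlw : 0 < l * w := mul_pos hl hw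
  have hp0 : 0 < p := by omega
  have hwp : w < p := by nlinarith
  have ht0 : 0 < t := by omega
  have hkt : k ≤ t := by nlinarith
  have hqt : q - t = 1 + (p - 1) * t := by rw [hq]; ring
  have hpk : (p - 1) * k ≤ (p - 1) * t := mul_le_mul_of_nonneg_left hkt (by omega)
  have htp : t ≤ (p - 1) * k := by rw [ht]; nlinarith
  -- Because (p - 1)k < q, the progression stays below 2q and wraps at most once.
  have hpos : ∀ x, 0 ≤ x → x < p → ((i + x * k) % q < K ↔
      (i + x * k < K ∨ (q ≤ i + x * k ∧ i + x * k < q + K))) := by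
    intro x hx hxp
    have h1 : x * k ≤ (p - 1) * k := mul_le_mul_of_nonneg_right (by omega) hk.le
    have h2 : 0 ≤ x * k := mul_nonneg hx hk.le
    by_cases h : i + x * k < q
    · rw [Int.emod_eq_of_lt (by omega) h]; omega
    · rw [← Int.sub_emod_right, Int.emod_eq_of_lt (by omega) (by omega)]; omega
  have h01 : c₀ ≤ c₁ := h₀.mono h₁ (by omega)
  have h12 : c₁ ≤ c₂ := h₁.mono h₂ (by omega)
  have h02 : c₂ ≤ c₀ + w := h₀.le_add hw.le ht h₂
  have hc₀ := h₀.nonneg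
  have hc₂ := h₂.le
  obtain ⟨m₁, hm₁⟩ : ∃ m, m = l * (c₁ - c₀) := ⟨_, rfl⟩
  obtain ⟨m₂, hm₂⟩ : ∃ m, m = l * (c₂ - c₀) := ⟨_, rfl⟩
  have hm0 : 0 ≤ m₁ := by rw [hm₁]; exact mul_nonneg hl.le (by omega)
  have hm12 : m₁ ≤ m₂ := by rw [hm₁, hm₂]; exact mul_le_mul_of_nonneg_left (by omega) hl.le
  have hm2p : m₂ ≤ p - 1 := by rw [hm₂, hp]; nlinarith
  have hD₁ := divResidue_sub hp0 (b - c₀) (c₁ - c₀) hm₁ hm0 (by omega)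
  have hD₂ := divResidue_sub hp0 (b - c₀) (c₂ - c₀) hm₂ (by omega) (by omega)
  rw [show b - c₀ - (c₁ - c₀) = b - c₁ by ring] at hD₁
  rw [show b - c₀ - (c₂ - c₀) = b - c₂ by ring] at hD₂
  have hz := fun {c : ℤ} (h : 0 ≤ c) (h' : c ≤ p) =>
    eq_or_of_divResidue_sub_eq_zero hp0 hp hb hbp h h'
  have hzero : ∀ c, divResidue p l (c - c) = 0 := fun c => by simp [divResidue]
  have hl₀ := divResidue_nonneg hp0 l (b - c₀)
  have hu₀ := divResidue_lt hp0 l (b - c₀)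
  have hl₁ := divResidue_nonneg hp0 l (b - c₁)
  have hu₁ := divResidue_lt hp0 l (b - c₁)
  have hl₂ := divResidue_nonneg hp0 l (b - c₂)
  have hu₂ := divResidue_lt hp0 l (b - c₂)
  have hb' : (b - 1) % p = if b = 0 then p - 1 else b - 1 := by
    split_ifs with h
    · subst h
      rw [← Int.add_emod_right, Int.emod_eq_of_lt (by omega) (by omega)]; ring
    · exact Int.emod_eq_of_lt (by omega) (by omega)
  have hc₂0 : 0 < c₂ := (h₂.lt_iff 0 le_rfl hp0).2 (by omega)
  rw [hb']
  have hkq : k < q := by nlinarith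
  have hup : (i + b * k) % q < K → ¬ (i + (if b = 0 then p - 1 else b - 1) * k) % q < K →
      (¬ (1 ≤ divResidue p l (b - c₂) ∧ divResidue p l (b - c₂) ≤ J) ∧
        ¬ divResidue p l (b - c₁) = J + 1) ∨
      ((1 ≤ divResidue p l (b - c₀) ∧ divResidue p l (b - c₀) ≤ J + 1) ∧
        ¬ ((1 ≤ divResidue p l (b - c₂) ∧ divResidue p l (b - c₂) ≤ J) ∧
          divResidue p l (b - c₁) = J + 1)) := by
    intro hP hP'
    rw [hpos b hb hbp] at hP
    by_cases hb0 : b = 0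
    · rw [if_pos hb0, hpos (p - 1) (by omega) (by omega)] at hP'
      have hbk : b * k = 0 := by rw [hb0, zero_mul]
      have hiK : i < K := by omega
      by_cases hc2p : c₂ = p
      · have : divResidue p l (b - c₂) = 0 := by
          rw [hc2p, divResidue_sub_self, hb0]; simp [divResidue]
        omega
      have hf := h₀.eq_add hk.le hw.le ht h₂ (by omega) (by omega)
      have hm : m₂ = p - 1 := by rw [hm₂, hf, hp]; ring
      have hci := h₀.lt_iff 0 le_rfl hp0
      have hD0 : divResidue p l (b - c₀) ≠ 0 := fun h => by
        have := hz hc₀ h₀.le h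
        omega
      -- Equality would force i ≥ Jt + s + 1 ≥ K, against i < K.
      have hC : divResidue p l (b - c₁) ≠ J + 1 := by
        intro hC
        obtain ⟨e, he⟩ := exists_mul_divResidue hp (b - c₁)
        rw [hC, hb0] at he
        have h1 : ¬ c₁ < c₁ := lt_irrefl _
        rw [h₁.lt_iff c₁ (by omega) (by omega), not_lt] at h1
        rw [hq, ht] at h1
        have := mul_add_le_of_mul_succ_eq hk hp0 hw (J := J) (e := e) (c := c₁) (by linarith)
          (by omega) (by omega) h1
        rw [← ht] at this
        omega
      omega
    · rw [if_neg hb0, hpos (b - 1) (by omega) (by omega)] at hP'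
      have hb1 : (b - 1) * k = b * k - k := by ring
      -- For b > 0 the progression can enter [0, K) mod q only by passing q, so b is the crossing
      -- index and D₂ = 0.
      have hbc : b = c₂ := by
        have hb₂ := h₂.lt_iff b hb hbp
        have hb₂' := h₂.lt_iff (b - 1) (by omega) (by omega)
        clear hD₁ hD₂
        omega
      have : divResidue p l (b - c₂) = 0 := by rw [← hbc]; exact hzero b
      clear hP hP'
      omega
  have hdown : ¬ (i + b * k) % q < K → (i + (if b = 0 then p - 1 else b - 1) * k) % q < K →
      1 ≤ divResidue p l (b - c₀) ∧ divResidue p l (b - c₀) ≤ J + 1 →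
      (1 ≤ divResidue p l (b - c₂) ∧ divResidue p l (b - c₂) ≤ J) ∨
        divResidue p l (b - c₁) = J + 1 := by
    intro hP hP' hA
    by_contra! hBC
    rw [hpos b hb hbp] at hP
    by_cases hb0 : b = 0
    · rw [if_pos hb0, hpos (p - 1) (by omega) (by omega)] at hP'
      have hbk : b * k = 0 := by rw [hb0, zero_mul]
      have hci := h₀.lt_iff 0 le_rfl hp0
      by_cases hII : i < q - t
      · have hlast := h₂.lt_iff (p - 1) (by omega) (by omega)
        have hc2p : c₂ < p := by
          clear hD₁ hD₂ hBC hci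
          omega
        have hf := h₀.eq_add hk.le hw.le ht h₂ hII hc2p
        have hm : m₂ = p - 1 := by rw [hm₂, hf, hp]; ring
        have : divResidue p l (b - c₂) = 0 := by
          clear hP hP' hci hlast
          omega
        have := hz hc₂0.le hc₂ this
        omega
      · have hc0 : c₀ = 0 := by omega
        have : divResidue p l (b - c₀) = 0 := by rw [hc0, hb0]; exact hzero 0
        omega
    rw [if_neg hb0, hpos (b - 1) (by omega) (by omega)] at hP'
    have hb1 : (b - 1) * k = b * k - k := by ring
    obtain ⟨e, he⟩ := exists_mul_divResidue hp b
    by_cases hII : i < q - t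
    · have hb₂ : i + b * k < q ∨ q ≤ i + (b - 1) * k := by
        clear hD₁ hD₂ hBC
        omega
      have hup : i + b * k < q → i + b * k < K + k := by
        clear hD₁ hD₂ hBC hb₂
        omega
      clear hP hP'
      have hb₂' : b ≠ c₂ := by
        have h1 := h₂.lt_iff b hb hbp
        have h2 := h₂.lt_iff (b - 1) (by omega) (by omega)
        clear hD₁ hD₂ hBC hup
        omega
      have hD2 : divResidue p l (b - c₂) ≠ 0 := fun h => by
        have := hz hc₂0.le hc₂ h
        clear hD₁ hD₂ hBC hup hb₂
        omega
      have hfl : c₂ ≠ c₀ + w := by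
        intro hf
        have hm : m₂ = p - 1 := by rw [hm₂, hf, hp]; ring
        clear hup hb₂
        omega
      -- A full crossing would give D₂ = D₀ - 1 and hence the excluded indicator; so the progression
      -- never reaches q.
      have hcp : c₂ = p := by
        by_contra hne
        exact hfl (h₀.eq_add hk.le hw.le ht h₂ hII (by clear hup hb₂ hD₁ hD₂ hBC; omega))
      have hDJ : J + 1 ≤ divResidue p l (b - c₂) := by
        clear hup hb₂ hD₁ hD₂
        omega
      have hbK : i + b * k < K + k := by
        apply hup
        have h2 := h₂.lt_iff b hb hbp
        clear hup hb₂ hD₁ hD₂ hBC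
        omega
      clear hup hb₂
      have h5 : (p - b) * k = (p - 1) * k + k - b * k := by ring
      -- Compare the bound i + bk < K + k with the last point i + (p - 1)k, which has passed q - t +
      -- s if D₂ = J + 1 and q - t if D₂ > J + 1.
      have hlow : (p - divResidue p l (b - c₂)) * t < (p - b) * k := by
        rcases hDJ.eq_or_lt with hE | hE
        · have hcp1 : c₁ ≠ p := fun h => by
            rw [h.trans hcp.symm] at hBC
            exact hBC.2 hE.symm
          have h3 : ¬ (p - 1 < c₁) := by
            clear hD₁ hD₂ hBC
            omega
          rw [h₁.lt_iff (p - 1) (by omega) (by omega)] at h3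
          rw [← hE]
          have h4 : (p - (J + 1)) * t = (p - 1) * t - J * t := by ring
          clear hD₁ hD₂ hBC
          omega
        · have hc02 : c₀ ≠ c₂ := fun h => by
            rw [h] at hA
            omega
          have h3 : ¬ (p - 1 < c₀) := by omega
          rw [h₀.lt_iff (p - 1) (by omega) (by omega)] at h3
          have : (J + 2) * t ≤ divResidue p l (b - c₂) * t :=
            mul_le_mul_of_nonneg_right (by omega) ht0.le
          have h4 : (p - divResidue p l (b - c₂)) * t =
            (p - 1) * t + t - divResidue p l (b - c₂) * t := by ring
          have h6 : (J + 2) * t = J * t + 2 * t := by ring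
          clear hD₁ hD₂ hBC
          omega
      rw [hcp, divResidue_sub_self, ht] at hlow
      exact not_mul_lt_mul_of_mul_eq hk hp0 hw he (divResidue_lt hp0 l b) hb hlow
    · have hb1k : 0 ≤ (b - 1) * k := mul_nonneg (by omega) hk.le
      have hqb : q + K ≤ i + b * k := by
        clear hD₁ hD₂ hBC
        omega
      clear hP hP'
      have hci := h₀.lt_iff 0 le_rfl hp0
      have hc0 : c₀ = 0 := by
        clear hD₁ hD₂ hBC
        omega
      have hbD : b * k ≤ divResidue p l (b - c₀) * t := by
        rw [ht, hc0, sub_zero]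
        exact mul_le_mul_of_mul_eq hk hp0 hw he (divResidue_nonneg hp0 l b) hbp
      rcases hA.2.eq_or_lt with hE | hE
      · have hc10 : c₁ ≠ 0 := fun h => by
          rw [h, ← hc0] at hBC
          exact hBC.2 hE
        have hci' := h₁.lt_iff 0 le_rfl hp0
        rw [hE, add_mul, one_mul] at hbD
        clear hD₁ hD₂ hBC
        omega
      · have : divResidue p l (b - c₀) * t ≤ J * t :=
          mul_le_mul_of_nonneg_right (by omega) ht0.le
        clear hD₁ hD₂ hBC
        omega
  have hR2 : 1 ≤ divResidue p l (b - c₂) ∧ divResidue p l (b - c₂) ≤ J →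
      divResidue p l (b - c₁) = J + 1 →
      1 ≤ divResidue p l (b - c₀) ∧ divResidue p l (b - c₀) ≤ J + 1 := by
    clear hup hdown
    omega
  exact abs_ite_sum_le_one hup hdown hR2

/-! ### Residue windows in coordinates modulo p and q. -/

theorem emod_eq_emod_of_dvd_sub {n x c : ℤ} (h : n ∣ x - c) : x % n = c % n :=
  Int.emod_eq_emod_iff_emod_sub_eq_zero.2 (Int.emod_eq_zero_of_dvd h)

/-- The indicator function of the residues `0, …, p - 1` modulo `p q`. -/
def residueWindow (p q : ℕ) (x : ℤ) : ℤ := if x % (p * q) < p then 1 else 0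

theorem emod_lt_iff_exists {p q : ℕ} (hp : 0 < p) (hq : 0 < q) (x : ℤ) :
    x % (p * q) < p ↔ ∃ c : ℤ, 0 ≤ c ∧ c < p ∧ (p * q : ℤ) ∣ x - c := by
  have hpq : (0 : ℤ) < p * q := by positivity
  have hle : (p : ℤ) ≤ p * q := by
    have : (1 : ℤ) ≤ q := by exact_mod_cast hq
    nlinarith
  constructor
  · intro h
    exact ⟨_, Int.emod_nonneg _ hpq.ne', h, Int.dvd_self_sub_emod⟩
  · rintro ⟨c, hc, hcp, h⟩
    rw [emod_eq_emod_of_dvd_sub h, Int.emod_eq_of_lt hc (by omega)]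
    exact hcp

/-- The window [0, p) is symmetric under c ↦ p - 1 - c. -/
theorem residueWindow_sub {p q : ℕ} (hp : 0 < p) (hq : 0 < q) (x : ℤ) :
    residueWindow p q (p - 1 - x) = residueWindow p q x := by
  unfold residueWindow
  congr 1
  apply propext
  rw [emod_lt_iff_exists hp hq, emod_lt_iff_exists hp hq]
  constructor
  · rintro ⟨c, hc, hcp, h⟩
    refine ⟨p - 1 - c, by omega, by omega, ?_⟩
    rwa [← dvd_neg, show -(x - (p - 1 - c)) = (p : ℤ) - 1 - x - c by ring]
  · rintro ⟨c, hc, hcp, h⟩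
    refine ⟨p - 1 - c, by omega, by omega, ?_⟩
    rwa [← dvd_neg, show -((p : ℤ) - 1 - x - (p - 1 - c)) = x - c by ring]

theorem invCyclotomicCoeff_eq (p q : ℕ) (x : ℤ) :
    invCyclotomicCoeff p q x = residueWindow p q x - residueWindow p q (x - q) := rfl

theorem invCyclotomicCoeff_reflect {p q : ℕ} (hp : 0 < p) (hq : 0 < q) (x : ℤ) :
    invCyclotomicCoeff p q (p + q - 1 - x) = -invCyclotomicCoeff p q x := by
  rw [invCyclotomicCoeff_eq, invCyclotomicCoeff_eq, ← residueWindow_sub hp hq x,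
    ← residueWindow_sub hp hq (x - q), show (p : ℤ) + q - 1 - x - q = p - 1 - x by ring,
    show (p : ℤ) - 1 - (x - q) = p + q - 1 - x by ring]
  ring

/-- Chinese remainders made explicit: q ≡ 1 mod p, and wpk ≡ -1 mod q. -/
theorem dvd_mul_add_mul_iff {p q w k A I : ℤ} (hq : q = 1 + p * (k * w)) :
    p * q ∣ A * q + w * p * I ↔ p ∣ A ∧ q ∣ I := by
  constructor
  · rintro ⟨z, hz⟩
    constructor
    · exact ⟨q * z - w * I - A * (k * w), by linear_combination hz - A * hq⟩
    · exact ⟨I - k * (p * z - A), by linear_combination -k * hz - I * hq⟩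
  · rintro ⟨⟨a, rfl⟩, ⟨b, rfl⟩⟩
    exact ⟨a + w * b, by ring⟩

theorem exists_coordinates {p q w k : ℤ} (hp : 0 < p) (hq0 : 0 < q) (hq : q = 1 + p * (k * w))
    (n : ℤ) : ∃ b i : ℤ, 0 ≤ b ∧ b < p ∧ 0 ≤ i ∧ i < q ∧ n ≡ b * q + w * p * i [ZMOD (p * q)] := by
  -- With b = n mod p, n - bq = pm for m = n/p - bkw, so wi ≡ m mod q is enough; the inverse of w
  -- mod q is -pk.
  refine ⟨n % p, (-(p * k * (n / p - n % p * (k * w)))) % q, Int.emod_nonneg _ hp.ne',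
    Int.emod_lt_of_pos _ hp, Int.emod_nonneg _ hq0.ne', Int.emod_lt_of_pos _ hq0, ?_⟩
  have h1 := Int.emod_add_mul_ediv n p
  set m := n / p - n % p * (k * w) with hm
  have h2 := Int.emod_add_mul_ediv (-(p * k * m)) q
  rw [Int.modEq_iff_dvd]
  refine ⟨-m - w * (-(p * k * m) / q), ?_⟩
  linear_combination w * p * h2 + h1 + (n % p + p * m) * hq + p * hm

open Classical in
theorem residueWindow_sub_mul {p q w k : ℕ} (hp : 0 < p) (hq : q = 1 + p * (k * w))
    (B i N d : ℤ) : residueWindow p q (B * q + w * p * i - (p * N + d) * w) =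
      if ∃ c : ℤ, 0 ≤ c ∧ c < p ∧ (p : ℤ) ∣ B - c - w * d ∧ (q : ℤ) ∣ i + c * k + d * (k * w) - N
      then 1 else 0 := by
  have hqZ : (q : ℤ) = 1 + p * (k * w) := by exact_mod_cast hq
  unfold residueWindow
  congr 1
  apply propext
  rw [emod_lt_iff_exists hp (by omega)]
  refine exists_congr fun c => and_congr_right fun _ => and_congr_right fun _ => ?_
  rw [← dvd_mul_add_mul_iff hqZ]
  apply iff_of_eq
  congr 1
  linear_combination (c + w * d) * hqZ

theorem sum_range_eq_ite {a : ℤ} (ha : 0 ≤ a) {K : ℕ} {f : ℕ → ℤ} {R : Prop} [Decidable R]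
    (hf : ∀ N < K, f N = if (N : ℤ) = a ∧ R then 1 else 0) :
    ∑ N ∈ Finset.range K, f N = if a < K ∧ R then 1 else 0 := by
  lift a to ℕ using ha
  rw [Finset.sum_congr rfl fun N hN => hf N (Finset.mem_range.1 hN)]
  by_cases hR : R
  · simp [hR]
  · simp [hR]

theorem sum_residueWindow_pos {p q w k : ℕ} (hp : 0 < p) (hq : q = 1 + p * (k * w))
    (B i : ℤ) {K : ℕ} (hK : K ≤ q) :
    ∑ N ∈ Finset.range K, residueWindow p q (B * q + w * p * i - (p * (N : ℤ) + 0) * w) =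
      if (i + B % p * k) % q < K then 1 else 0 := by
  have hp0 : (0 : ℤ) < p := by exact_mod_cast hp
  have hq0 : (0 : ℤ) < q := by omega
  simp only [residueWindow_sub_mul hp hq]
  rw [sum_range_eq_ite (a := (i + B % p * k) % q) (R := True) (Int.emod_nonneg _ hq0.ne')]
  · simp
  · intro N hN
    congr 1
    apply propext
    simp only [mul_zero, sub_zero, zero_mul, add_zero, and_true]
    constructor
    · rintro ⟨c, hc, hcp, h1, h2⟩
      have : B % p = c := by
        rw [emod_eq_emod_of_dvd_sub h1, Int.emod_eq_of_lt hc hcp]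
      rw [this, emod_eq_emod_of_dvd_sub h2, Int.emod_eq_of_lt (by omega) (by omega)]
    · intro h
      refine ⟨B % p, Int.emod_nonneg _ hp0.ne', Int.emod_lt_of_pos _ hp0,
        Int.dvd_self_sub_emod, ?_⟩
      rw [h]
      exact Int.dvd_self_sub_emod

theorem divResidue_eq_iff {p l w x d : ℤ} (hp0 : 0 < p) (hp : p = 1 + l * w) (hd : 0 ≤ d)
    (hdp : d < p) : divResidue p l x = d ↔ p ∣ x - w * d := by
  obtain ⟨e, he⟩ := exists_mul_divResidue hp x
  constructor
  · intro h
    rw [h] at he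
    exact ⟨-e, by linear_combination -he⟩
  · rintro ⟨z, hz⟩
    have h : p ∣ divResidue p l x - d :=
      ⟨divResidue p l x - d - l * (z + e), by
        linear_combination (d - divResidue p l x) * hp - l * he - l * hz⟩
    have h1 := divResidue_nonneg hp0 l x
    have h2 := divResidue_lt hp0 l x
    have := Int.eq_zero_of_abs_lt_dvd h (by rw [abs_lt]; constructor <;> omega)
    omega

/-- Put d = ⌊N/t⌋ + 1 and y = N mod t. Then dt - N = t - y, so the congruence mod q fixes y = i + ck
- (q - t), while the one mod p fixes d. Each admissible c thus determines a single N = (d - 1)t + y,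
which counts iff N < K. -/
theorem sum_residueWindow_neg {p q w k l t : ℕ} (hw : 0 < w) (hk : 0 < k) (hp : p = 1 + l * w)
    (ht : t = k * w) (hq : q = 1 + p * t) (B : ℤ) {i : ℤ} (hi : 0 ≤ i) (hiq : i < q)
    {K : ℕ} (hK : K ≤ (p - 1) * t) :
    ∑ N ∈ Finset.range K, residueWindow p q
        (B * q + w * p * i - (p * (N : ℤ) + ((N / t + 1 : ℕ) : ℤ)) * w) =
      ∑ c ∈ Finset.range p, if (q : ℤ) - t ≤ i + c * k ∧ i + c * k < q ∧
        1 ≤ divResidue p l (B - c) ∧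
        (divResidue p l (B - c) - 1) * t + (i + c * k - (q - t)) < K then 1 else 0 := by
  have hp0 : 0 < p := by omega
  have ht0 : 0 < t := by rw [ht]; positivity
  have hpZ : (p : ℤ) = 1 + l * w := by exact_mod_cast hp
  have htZ : (t : ℤ) = k * w := by exact_mod_cast ht
  have hqZ : (q : ℤ) = 1 + p * t := by exact_mod_cast hq
  have hp0Z : (0 : ℤ) < p := by exact_mod_cast hp0
  have hdiv : ∀ N < K, N / t + 1 < p := by
    intro N hN
    have : N / t < p - 1 := by
      rw [Nat.div_lt_iff_lt_mul ht0]
      omega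
    omega
  have hkt : (k : ℤ) ≤ t := by
    rw [htZ]; have : (1 : ℤ) ≤ w := by exact_mod_cast hw
    nlinarith
  have step : ∀ N ∈ Finset.range K, residueWindow p q
      (B * q + w * p * i - (p * (N : ℤ) + ((N / t + 1 : ℕ) : ℤ)) * w) =
      ∑ c ∈ Finset.range p, if (p : ℤ) ∣ B - c - w * ((N / t + 1 : ℕ) : ℤ) ∧
        (q : ℤ) ∣ i + c * k + ((N / t + 1 : ℕ) : ℤ) * (k * w) - N then 1 else 0 := by
    intro N _
    rw [residueWindow_sub_mul hp0 (ht ▸ hq)]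
    set d : ℤ := ((N / t + 1 : ℕ) : ℤ)
    rw [sum_range_eq_ite (a := (B - w * d) % p)
      (R := (q : ℤ) ∣ i + (B - w * d) % p * k + d * (k * w) - N) (Int.emod_nonneg _ hp0Z.ne')]
    · congr 1
      apply propext
      rw [and_iff_right (Int.emod_lt_of_pos _ hp0Z)]
      constructor
      · rintro ⟨c, hc, hcp, h1, h2⟩
        have : (B - w * d) % p = c := by
          rw [emod_eq_emod_of_dvd_sub (c := c) (by convert h1 using 1; ring),
            Int.emod_eq_of_lt hc hcp]
        rwa [this]
      · intro h
        refine ⟨_, Int.emod_nonneg _ hp0Z.ne', Int.emod_lt_of_pos _ hp0Z, ?_, h⟩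
        convert Int.dvd_self_sub_emod (x := B - w * d) (m := (p : ℤ)) using 1
        ring
    · intro c hc
      refine if_congr ?_ rfl rfl
      have hcc : (p : ℤ) ∣ B - c - w * d ↔ (c : ℤ) = (B - w * d) % p := by
        constructor
        · intro h1
          rw [emod_eq_emod_of_dvd_sub (c := (c : ℤ)) (by convert h1 using 1; ring),
            Int.emod_eq_of_lt (by omega) (by omega)]
        · intro h
          rw [h]
          convert Int.dvd_self_sub_emod (x := B - w * d) (m := (p : ℤ)) using 1
          ring
      rw [hcc]
      constructor
      · rintro ⟨h1, h2⟩
        exact ⟨h1, h1 ▸ h2⟩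
      · rintro ⟨h1, h2⟩
        exact ⟨h1, h1 ▸ h2⟩
  rw [Finset.sum_congr rfl step, Finset.sum_comm]
  refine Finset.sum_congr rfl fun c hc => ?_
  have hcp : (c : ℤ) < p := by exact_mod_cast Finset.mem_range.1 hc
  have hck : (c : ℤ) * k ≤ (p - 1) * t :=
    mul_le_mul (by omega) hkt (by omega) (by omega)
  have hck0 : (0 : ℤ) ≤ c * k := by positivity
  have hqt : (q : ℤ) = 1 + (p - 1) * t + t := by rw [hqZ]; ring
  have key : ∀ N < K, ((p : ℤ) ∣ B - c - w * ((N / t + 1 : ℕ) : ℤ) ∧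
      (q : ℤ) ∣ i + c * k + ((N / t + 1 : ℕ) : ℤ) * (k * w) - N) ↔
      (divResidue p l (B - c) = ((N / t : ℕ) : ℤ) + 1 ∧
        ((N % t : ℕ) : ℤ) = i + c * k - (q - t)) := by
    intro N hN
    have hd := hdiv N hN
    rw [← Nat.cast_succ, divResidue_eq_iff hp0Z hpZ (Int.natCast_nonneg _) (by exact_mod_cast hd)]
    have hNt : ((N % t : ℕ) : ℤ) + t * ((N / t : ℕ) : ℤ) = N := by
      exact_mod_cast Nat.mod_add_div N t
    have hlt : ((N % t : ℕ) : ℤ) < t := by exact_mod_cast Nat.mod_lt N ht0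
    have e1 : i + c * k + ((N / t + 1 : ℕ) : ℤ) * (k * w) - N =
        i + c * k + t - ((N % t : ℕ) : ℤ) := by
      rw [Nat.cast_succ, ← htZ]
      linear_combination hNt
    rw [e1]
    refine and_congr_right fun _ => ?_
    constructor
    -- The multiple of q lies strictly between 0 and 2q, so it is q itself.
    · rintro ⟨z, hz⟩
      have hz2 : z < 2 := by
        refine lt_of_mul_lt_mul_left (a := (q : ℤ)) ?_ (by omega)
        omega
      have hz0 : 0 < z := by
        refine lt_of_mul_lt_mul_left (a := (q : ℤ)) ?_ (by omega)
        omega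
      have : z = 1 := by omega
      rw [this] at hz
      omega
    · intro h
      exact ⟨1, by omega⟩
  by_cases hcond : (q : ℤ) - t ≤ i + c * k ∧ i + c * k < q ∧ 1 ≤ divResidue p l (B - c)
  · obtain ⟨h1, h2, h3⟩ := hcond
    obtain ⟨x, hx⟩ : ∃ x : ℕ, divResidue p l (B - c) = x + 1 :=
      ⟨(divResidue p l (B - c) - 1).toNat, by omega⟩
    obtain ⟨y, hy⟩ : ∃ y : ℕ, i + c * k - (q - t) = y :=
      ⟨(i + c * k - (q - t)).toNat, by omega⟩
    rw [sum_range_eq_ite (a := ((x * t + y : ℕ) : ℤ)) (R := True) (by omega)]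
    · congr 1
      rw [hy, hx]
      push_cast
      apply propext
      simp only [add_sub_cancel_right, and_true]
      constructor
      · intro h; exact ⟨h1, h2, by omega, h⟩
      · intro h; exact h.2.2.2
    · intro N hN
      refine if_congr ?_ rfl rfl
      rw [key N hN, hx, hy]
      have hyt : y < t := by omega
      have hNt := Nat.mod_add_div N t
      constructor
      · rintro ⟨h4, h5⟩
        have h4' : N / t = x := by omega
        have h5' : N % t = y := by omega
        rw [h4', h5'] at hNt
        refine ⟨?_, trivial⟩
        rw [← hNt]
        push_cast; ring
      · rintro ⟨h4, -⟩
        have h4' : N = t * x + y := by rw [mul_comm]; exact_mod_cast h4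
        rw [h4', Nat.mul_add_div ht0, Nat.div_eq_of_lt hyt, Nat.mul_add_mod,
          Nat.mod_eq_of_lt hyt]
        exact ⟨by simp, rfl⟩
  · rw [if_neg (by tauto)]
    refine Finset.sum_eq_zero fun N hN => if_neg ?_
    rw [key N (Finset.mem_range.1 hN)]
    rintro ⟨h1, h2⟩
    have hlt : ((N % t : ℕ) : ℤ) < t := by exact_mod_cast Nat.mod_lt N ht0
    have h0 : (0 : ℤ) ≤ ((N / t : ℕ) : ℤ) := Int.natCast_nonneg _
    exact hcond ⟨by omega, by omega, by omega⟩

/-! ### Telescoping, and the bound for r ≡ ±w. -/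

theorem sum_range_ite_telescope (g₁ g₂ : ℤ → ℤ) {c₀ c₁ c₂ : ℤ} {p : ℕ} (h0 : 0 ≤ c₀)
    (h01 : c₀ ≤ c₁) (h12 : c₁ ≤ c₂) (h2 : c₂ ≤ p) :
    ∑ c ∈ Finset.range p, (if c₀ ≤ c ∧ (c : ℤ) < c₁ then g₁ c - g₁ (c + 1)
      else if c₁ ≤ c ∧ (c : ℤ) < c₂ then g₂ c - g₂ (c + 1) else 0) =
      g₁ c₀ - g₁ c₁ + (g₂ c₁ - g₂ c₂) := by
  -- Clamping c to [c₀, c₁] and to [c₁, c₂] merges both pieces into one telescoping sum.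
  have h := Finset.sum_range_sub' (fun c : ℕ => g₁ (max c₀ (min c c₁)) + g₂ (max c₁ (min c c₂))) p
  have e1 : max c₀ (min ((0 : ℕ) : ℤ) c₁) = c₀ := by omega
  have e2 : max c₁ (min ((0 : ℕ) : ℤ) c₂) = c₁ := by omega
  have e3 : max c₀ (min (p : ℤ) c₁) = c₁ := by omega
  have e4 : max c₁ (min (p : ℤ) c₂) = c₂ := by omega
  simp only [e1, e2, e3, e4] at h
  rw [show g₁ c₀ - g₁ c₁ + (g₂ c₁ - g₂ c₂) = g₁ c₀ + g₂ c₁ - (g₁ c₁ + g₂ c₂) by ring, ← h]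
  refine Finset.sum_congr rfl fun c _ => ?_
  push_cast
  split_ifs with h3 h4
  · rw [show max c₀ (min (c : ℤ) c₁) = c by omega, show max c₀ (min ((c : ℤ) + 1) c₁) = c + 1 by omega,
      show max c₁ (min (c : ℤ) c₂) = c₁ by omega, show max c₁ (min ((c : ℤ) + 1) c₂) = c₁ by omega]
    ring
  · rw [show max c₀ (min (c : ℤ) c₁) = c₁ by omega, show max c₀ (min ((c : ℤ) + 1) c₁) = c₁ by omega,
      show max c₁ (min (c : ℤ) c₂) = c by omega, show max c₁ (min ((c : ℤ) + 1) c₂) = c + 1 by omega]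
    ring
  · have : max c₀ (min (c : ℤ) c₁) = max c₀ (min ((c : ℤ) + 1) c₁) := by omega
    have h' : max c₁ (min (c : ℤ) c₂) = max c₁ (min ((c : ℤ) + 1) c₂) := by omega
    rw [this, h']
    ring

theorem abs_sum_invCyclotomicCoeff_le_one {p q w k l t : ℕ} (hw : 0 < w) (hk : 0 < k) (hl : 0 < l)
    (hp : p = 1 + l * w) (ht : t = k * w) (hq : q = 1 + p * t) {K K' : ℕ} (hK : K ≤ (p - 1) * t)
    (hKK' : K ≤ K') (hK' : K' ≤ K + 1) (n : ℤ) :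
    |∑ N ∈ Finset.range K', invCyclotomicCoeff p q (n - (p * (N : ℤ) + 0) * w) -
      ∑ N ∈ Finset.range K,
        invCyclotomicCoeff p q (n - (p * (N : ℤ) + ((N / t + 1 : ℕ) : ℤ)) * w)| ≤ 1 := by
  have hp0 : 0 < p := by omega
  have ht0 : 0 < t := by rw [ht]; positivity
  have hpZ : (p : ℤ) = 1 + l * w := by exact_mod_cast hp
  have htZ : (t : ℤ) = k * w := by exact_mod_cast ht
  have hqZ : (q : ℤ) = 1 + p * t := by exact_mod_cast hq
  have hqt : q = (p - 1) * t + t + 1 := by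
    obtain ⟨m, rfl⟩ : ∃ m, p = m + 1 := ⟨p - 1, by omega⟩
    rw [hq]; simp only [Nat.add_sub_cancel]; ring
  have hq' : q = 1 + p * (k * w) := ht ▸ hq
  obtain ⟨b, i, hb, hbp, hi, hiq, hn⟩ := exists_coordinates (p := p) (q := q) (w := w) (k := k)
    (by omega) (by omega) (by exact_mod_cast hq') n
  -- The shift by q in χ is the shift from b to b - 1.
  have hχ : ∀ y : ℤ, invCyclotomicCoeff p q (n - y) =
      residueWindow p q (b * q + w * p * i - y) -
        residueWindow p q ((b - 1) * q + w * p * i - y) := by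
    intro y
    rw [invCyclotomicCoeff_congr p q (hn.sub_right y), invCyclotomicCoeff_eq]
    congr 2
    ring
  simp only [hχ, Finset.sum_sub_distrib]
  rw [sum_residueWindow_pos hp0 hq' b i (by omega),
    sum_residueWindow_pos hp0 hq' (b - 1) i (by omega), Int.emod_eq_of_lt hb hbp,
    sum_residueWindow_neg hw hk hp ht hq b hi hiq hK,
    sum_residueWindow_neg hw hk hp ht hq (b - 1) hi hiq hK, ← Finset.sum_sub_distrib]
  obtain ⟨J, hJ⟩ : ∃ J : ℤ, J = ((K / t : ℕ) : ℤ) := ⟨_, rfl⟩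
  obtain ⟨s, hs⟩ : ∃ s : ℤ, s = ((K % t : ℕ) : ℤ) := ⟨_, rfl⟩
  have hJ0 : 0 ≤ J := hJ ▸ Int.natCast_nonneg _
  have hs0 : 0 ≤ s := hs ▸ Int.natCast_nonneg _
  have hst : s < t := by rw [hs]; exact_mod_cast Nat.mod_lt K ht0
  have hKJ : (K : ℤ) = J * t + s := by
    rw [hJ, hs]
    exact_mod_cast (Nat.div_add_mod' K t).symm
  have hp0Z : (0 : ℤ) < p := by exact_mod_cast hp0
  have hk0Z : (0 : ℤ) < k := by exact_mod_cast hk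
  obtain ⟨c₀, h₀⟩ := exists_isFirstIndex hp0Z.le hk0Z i (q - t)
  obtain ⟨c₁, h₁⟩ := exists_isFirstIndex hp0Z.le hk0Z i (q - t + s)
  obtain ⟨c₂, h₂⟩ := exists_isFirstIndex hp0Z.le hk0Z i q
  have hneg := sum_range_ite_telescope
    (fun c => if 1 ≤ divResidue p l (b - c) ∧ divResidue p l (b - c) ≤ J + 1 then 1 else 0)
    (fun c => if 1 ≤ divResidue p l (b - c) ∧ divResidue p l (b - c) ≤ J then 1 else 0)
    h₀.nonneg (h₀.mono h₁ (by omega)) (h₁.mono h₂ (by omega)) h₂.le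
  -- Lexicographic comparison of (D - 1)t + y with K = Jt + s.
  have hlev : ∀ D y : ℤ, 0 ≤ y → y < t →
      ((D - 1) * t + y < K ↔ if y < s then D ≤ J + 1 else D ≤ J) := by
    intro D y hy hyt
    rw [hKJ]
    have ht0Z : (0 : ℤ) < t := by exact_mod_cast ht0
    split_ifs with hys
    · constructor
      · intro h
        have : D - 1 < J + 1 := by
          refine lt_of_mul_lt_mul_right ?_ ht0Z.le
          linarith
        omega
      · intro h
        have : (D - 1) * t ≤ J * t := mul_le_mul_of_nonneg_right (by omega) ht0Z.le
        omega
    · constructor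
      · intro h
        have : D - 1 < J := by
          refine lt_of_mul_lt_mul_right ?_ ht0Z.le
          linarith
        omega
      · intro h
        have : D * t ≤ J * t := mul_le_mul_of_nonneg_right h ht0Z.le
        linarith
  have hsum : ∑ c ∈ Finset.range p, ((if (q : ℤ) - t ≤ i + c * k ∧ i + c * k < q ∧
        1 ≤ divResidue p l (b - c) ∧
        (divResidue p l (b - c) - 1) * t + (i + c * k - (q - t)) < K then (1 : ℤ) else 0) -
      if (q : ℤ) - t ≤ i + c * k ∧ i + c * k < q ∧
        1 ≤ divResidue p l (b - 1 - c) ∧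
        (divResidue p l (b - 1 - c) - 1) * t + (i + c * k - (q - t)) < K then 1 else 0) =
      (if 1 ≤ divResidue p l (b - c₀) ∧ divResidue p l (b - c₀) ≤ J + 1 then (1 : ℤ) else 0) -
        (if 1 ≤ divResidue p l (b - c₁) ∧ divResidue p l (b - c₁) ≤ J + 1 then (1 : ℤ) else 0) +
      ((if 1 ≤ divResidue p l (b - c₁) ∧ divResidue p l (b - c₁) ≤ J then (1 : ℤ) else 0) -
        (if 1 ≤ divResidue p l (b - c₂) ∧ divResidue p l (b - c₂) ≤ J then (1 : ℤ) else 0)) := by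
    rw [← hneg]
    refine Finset.sum_congr rfl fun c hc => ?_
    have hcp : (c : ℤ) < p := by exact_mod_cast Finset.mem_range.1 hc
    have hc0 : (0 : ℤ) ≤ c := Int.natCast_nonneg _
    have e₀ := h₀.lt_iff c hc0 hcp
    have e₁ := h₁.lt_iff c hc0 hcp
    have e₂ := h₂.lt_iff c hc0 hcp
    rw [show b - 1 - (c : ℤ) = b - (c + 1) by ring]
    by_cases hin : (q : ℤ) - t ≤ i + c * k ∧ i + c * k < q
    · have hlev' := fun D => hlev D (i + c * k - (q - t)) (by omega) (by omega)
      simp only [hlev', hin.1, hin.2, true_and]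
      by_cases hys : i + c * k - (q - t) < s
      · rw [if_pos (by omega : c₀ ≤ c ∧ (c : ℤ) < c₁)]
        simp only [if_pos hys]
      · rw [if_neg (by omega : ¬ (c₀ ≤ c ∧ (c : ℤ) < c₁)),
          if_pos (by omega : c₁ ≤ c ∧ (c : ℤ) < c₂)]
        simp only [if_neg hys]
    · rw [if_neg (by tauto), if_neg (by tauto), if_neg (by omega), if_neg (by omega), sub_zero]
  rw [hsum]
  -- The cutoff drops from J + 1 to J at c₁, leaving only the level J + 1 there.
  have hsplit : (if 1 ≤ divResidue p l (b - c₁) ∧ divResidue p l (b - c₁) ≤ J + 1 then (1 : ℤ)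
      else 0) - (if 1 ≤ divResidue p l (b - c₁) ∧ divResidue p l (b - c₁) ≤ J then 1 else 0) =
      if divResidue p l (b - c₁) = J + 1 then 1 else 0 := by
    split_ifs <;> omega
  have hqtZ : (q : ℤ) - t = 1 + (p - 1) * t := by rw [hqZ]; ring
  have hbound := abs_boundary_sum_le_one (by exact_mod_cast hw) hk0Z (by exact_mod_cast hl) hpZ htZ
    hqZ hJ0 hs0 hst (K := K') (by omega) (by omega) (by omega) (by omega) hi hiq hb hbp h₀ h₁ h₂
  convert hbound using 2
  linear_combination hsplit

theorem abs_sum_invCyclotomicCoeff_of_modEq_le_one {p q w k l t : ℕ} (hw : 0 < w) (hk : 0 < k)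
    (hl : 0 < l) (hp : p = 1 + l * w) (ht : t = k * w) (hq : q = 1 + p * t) {r : ℤ}
    (hr : r ≡ w [ZMOD (p * q)] ∨ r ≡ -w [ZMOD (p * q)]) {K K' : ℕ} (hK : K ≤ (p - 1) * t)
    (hKK' : K ≤ K') (hK' : K' ≤ K + 1) (n : ℤ) :
    |∑ N ∈ Finset.range K', invCyclotomicCoeff p q (n - (p * (N : ℤ) + 0) * r) -
      ∑ N ∈ Finset.range K,
        invCyclotomicCoeff p q (n - (p * (N : ℤ) + ((N / t + 1 : ℕ) : ℤ)) * r)| ≤ 1 := by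
  have hp0 : 0 < p := by omega
  rcases hr with hr | hr
  · have h : ∀ y : ℤ, invCyclotomicCoeff p q (n - y * r) = invCyclotomicCoeff p q (n - y * w) :=
      fun y => invCyclotomicCoeff_congr p q ((hr.mul_left y).sub_left n)
    simp only [h]
    exact abs_sum_invCyclotomicCoeff_le_one hw hk hl hp ht hq hK hKK' hK' n
  · have h : ∀ y : ℤ, invCyclotomicCoeff p q (n - y * r) =
        -invCyclotomicCoeff p q (p + q - 1 - n - y * w) := fun y => by
      rw [invCyclotomicCoeff_congr p q ((hr.mul_left y).sub_left n),
        ← invCyclotomicCoeff_reflect hp0 (by omega : 0 < q)]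
      congr 1
      ring
    simp only [h, Finset.sum_neg_distrib]
    rw [neg_sub_neg, abs_sub_comm]
    exact abs_sum_invCyclotomicCoeff_le_one hw hk hl hp ht hq hK hKK' hK' _

/-! ### Truncation at n and conclusion. -/

theorem exists_forall_lt_iff_of_monotone {e : ℕ → ℕ} (he : Monotone e) (m n : ℕ) :
    ∃ K ≤ m, ∀ i < m, e i ≤ n ↔ i < K := by
  induction m with
  | zero => exact ⟨0, le_rfl, fun i hi => absurd hi (Nat.not_lt_zero i)⟩
  | succ m ih =>
    by_cases h : e m ≤ n
    · exact ⟨m + 1, le_rfl, fun i hi =>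
        ⟨fun _ => hi, fun _ => (he (Nat.lt_succ_iff.1 hi)).trans h⟩⟩
    · obtain ⟨K, hK, hi⟩ := ih
      refine ⟨K, by omega, fun i him => ?_⟩
      rcases Nat.lt_succ_iff_lt_or_eq.1 him with h1 | rfl
      · exact hi i h1
      · exact ⟨fun h' => absurd h' h, fun h' => absurd h' (by omega)⟩

theorem sum_range_ite_eq_sum_range {m K : ℕ} (hK : K ≤ m) {P : ℕ → Prop} [DecidablePred P]
    (h : ∀ i < m, P i ↔ i < K) (f : ℕ → ℤ) :
    ∑ i ∈ Finset.range m, (if P i then f i else 0) = ∑ i ∈ Finset.range K, f i := by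
  rw [← Finset.sum_filter]
  refine Finset.sum_congr ?_ fun _ _ => rfl
  ext i
  simp only [Finset.mem_filter, Finset.mem_range]
  constructor
  · rintro ⟨h1, h2⟩
    exact (h i h1).1 h2
  · intro h1
    exact ⟨h1.trans_le hK, (h i (h1.trans_le hK)).2 h1⟩

theorem abs_coeff_cyclotomic_ternary_le_one {p q r w : ℕ}
    (hp : p.Prime) (hq : q.Prime) (hr : r.Prime) (hpq : p < q) (hqr : q < r) (hw : 0 < w)
    (hrw : (r : ℤ) ≡ w [ZMOD (p * q)] ∨ (r : ℤ) ≡ -w [ZMOD (p * q)])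
    (hpw : p ≡ 1 [MOD w]) (hqpw : q ≡ 1 [MOD p * w]) (n : ℕ) :
    |(Polynomial.cyclotomic (p * q * r) ℤ).coeff n| ≤ 1 := by
  obtain ⟨l, hl⟩ := (Nat.modEq_iff_dvd' hp.one_lt.le).1 hpw.symm
  obtain ⟨k, hk⟩ := (Nat.modEq_iff_dvd' hq.one_lt.le).1 hqpw.symm
  have hp1 := hp.one_lt
  have hq1 := hq.one_lt
  have hl0 : 0 < l := Nat.pos_of_ne_zero (by rintro rfl; omega)
  have hk0 : 0 < k := Nat.pos_of_ne_zero (by rintro rfl; omega)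
  have hp' : p = 1 + l * w := by rw [mul_comm]; omega
  obtain ⟨t, ht⟩ : ∃ t, t = k * w := ⟨_, rfl⟩
  have hq' : q = 1 + p * t := by
    rw [ht, mul_comm k w, ← mul_assoc]; omega
  have ht0 : 0 < t := by rw [ht]; positivity
  rw [coeff_cyclotomic_ternary hp hq hr hpq hqr hq' n]
  obtain ⟨K', hK'm, hK'⟩ := exists_forall_lt_iff_of_monotone (e := fun i => i * p * r)
    (fun a b hab => by dsimp only; gcongr) ((p - 1) * t + 1) n
  obtain ⟨K, hKm, hK⟩ := exists_forall_lt_iff_of_monotone (e := fun N => (p * N + N / t + 1) * r)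
    (fun a b hab => by
      have := Nat.div_le_div_right (c := t) hab
      dsimp only; gcongr) ((p - 1) * t) n
  rw [sum_range_ite_eq_sum_range hK'm hK', sum_range_ite_eq_sum_range hKm hK]
  -- The exponents alternate: pN < pN + ⌊N/t⌋ + 1 < p(N + 1), the latter because ⌊N/t⌋ < p - 1. Thus
  -- the two truncation lengths differ by at most one.
  have h1 : K ≤ K' := by
    by_contra! hlt
    refine absurd ((hK' K' (by omega)).1 (le_trans ?_ ((hK K' (by omega)).2 hlt))) (lt_irrefl _)
    apply Nat.mul_le_mul_right
    rw [mul_comm, add_assoc]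
    exact Nat.le_add_right _ _
  have h2 : K' ≤ K + 1 := by
    by_contra! hlt
    refine absurd ((hK K (by omega)).1 (le_trans ?_ ((hK' (K + 1) (by omega)).2 hlt)))
      (lt_irrefl _)
    apply Nat.mul_le_mul_right
    have : K / t < p - 1 := by
      rw [Nat.div_lt_iff_lt_mul ht0]
      omega
    have : (K + 1) * p = p * K + p := by ring
    omega
  have := abs_sum_invCyclotomicCoeff_of_modEq_le_one hw hk0 hl0 hp' ht hq' hrw hKm h1 h2 n
  convert this using 3
  · refine Finset.sum_congr rfl fun N _ => ?_
    congr 1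
    ring
  · refine Finset.sum_congr rfl fun N _ => ?_
    congr 1

theorem Polynomial.Monic.coeffHeight_eq_one {f : Polynomial ℤ} (hf : f.Monic)
    (h : ∀ n, |f.coeff n| ≤ 1) : f.coeffHeight = 1 := by
  unfold Polynomial.coeffHeight
  apply le_antisymm
  · exact Finset.sup_le fun n _ => by have := abs_le.1 (h n); omega
  · have hmem : f.natDegree ∈ f.support := Polynomial.natDegree_mem_support_of_nonzero hf.ne_zero
    have := Finset.le_sup (f := fun n => (f.coeff n).natAbs) hmem
    simpa [hf.coeff_natDegree] using this

theorem mainTheorem2 (p q r w : ℕ)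
    (hp : p.Prime) (hq : q.Prime) (hr : r.Prime) (hpq : p < q) (hqr : q < r) (hw : 0 < w)
    (hrw : (r : ℤ) ≡ w [ZMOD ((p * q : ℕ) : ℤ)] ∨ (r : ℤ) ≡ -w [ZMOD ((p * q : ℕ) : ℤ)])
    (hpw : p ≡ 1 [MOD w]) (hqpw : q ≡ 1 [MOD p * w]) :
    cyclotomicHeight (p * q * r) = 1 := by
  rw [Nat.cast_mul] at hrw
  exact (Polynomial.cyclotomic.monic _ ℤ).coeffHeight_eq_one
    (abs_coeff_cyclotomic_ternary_le_one hp hq hr hpq hqr hw hrw hpw hqpw)
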